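/- For $n \ge 0$ let $\gamma_n$ be the standard Gaussian measure on $\mathbb{R}^n$; variances and covariances of functions on $\mathbb{R}^n$ are taken with respect to $\gamma_n$. For a bounded measurable $f : \mathbb{R}^n \to \mathbb{R}$, $t > 0$ and $y \in \mathbb{R}^n$, put $$P_t f(x) = \int f\bigl(e^{-t} x + \sqrt{1-e^{-2t}}\, z\bigr)\, d\gamma_n(z), \qquad f_{t,y}(x) = f\bigl(\sqrt{1-e^{-2t}}\, x + e^{-t} y\bigr),$$ $$M(f) = \sup_{A} \operatorname{Cov}(f, 1_A),$$ where the supremum is over all half-spaces $A = \{x \in \mathbb{R}^n : \langle x, a\rangle \le b\}$ with $a \in \mathbb{R}^n$, $b \in \mathbb{R}$. **Theorem.** There is a universal constant $c > 0$ such that for every $n$, every measurable $f : \mathbb{R}^n \to [0,1]$ and every $t > 0$, the function $y \mapsto M(f_{t,y})$ is $\gamma_n$-integrable and $$\mathbb{E}\, M(f_{t,Y}) \ge c\,(e^{2t} - 1)\operatorname{Var}(P_t f), \qquad Y \sim \gamma_n.$$ -/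

import Mathlib

open MeasureTheory ProbabilityTheory

noncomputable section

namespace GaussianNoise

/-- The standard Gaussian measure `γ_n` on `ℝⁿ` (with its Euclidean structure). -/
abbrev gammaMeasure (n : ℕ) : Measure (EuclideanSpace ℝ (Fin n)) :=
  stdGaussian (EuclideanSpace ℝ (Fin n))

/-- The Ornstein–Uhlenbeck semigroup
`P_t f (x) = E f (e^{-t} x + √(1 - e^{-2t}) X)`, where `X ∼ γ_n`. -/
def ornsteinUhlenbeck {n : ℕ} (t : ℝ) (f : EuclideanSpace ℝ (Fin n) → ℝ)
    (x : EuclideanSpace ℝ (Fin n)) : ℝ :=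
  ∫ z, f (Real.exp (-t) • x + √(1 - Real.exp (-2 * t)) • z) ∂(gammaMeasure n)

/-- The rescaled and shifted function `f_{t,y} (x) = f (√(1 - e^{-2t}) x + e^{-t} y)`. -/
def scaleShift {n : ℕ} (t : ℝ) (y : EuclideanSpace ℝ (Fin n))
    (f : EuclideanSpace ℝ (Fin n) → ℝ) (x : EuclideanSpace ℝ (Fin n)) : ℝ :=
  f (√(1 - Real.exp (-2 * t)) • x + Real.exp (-t) • y)

/-- The collection of all half-spaces `{x ∈ ℝⁿ : ⟨x, a⟩ ≤ b}`. -/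
def halfSpaces (n : ℕ) : Set (Set (EuclideanSpace ℝ (Fin n))) :=
  {A | ∃ (a : EuclideanSpace ℝ (Fin n)) (b : ℝ), A = {x | inner ℝ x a ≤ b}}

/-- `M(f)`, the supremum of `Cov(f, 1_A)` under `γ_n` over all half-spaces `A`.
For measurable `f` with values in `[0, 1]` the covariances lie in `[-1, 1]`,
so this is a genuine supremum. -/
def halfSpaceCorrelation {n : ℕ} (f : EuclideanSpace ℝ (Fin n) → ℝ) : ℝ :=
  sSup {r | ∃ A ∈ halfSpaces n, r = cov[f, A.indicator (fun _ => (1 : ℝ)); gammaMeasure n]}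

end GaussianNoise

end

/-! ### Gaussian shifts and exponential moments -/

section CameronMartin

variable {ι : Type*} [Fintype ι]

/-! The link between both sides is the vector `v(y) = E f_{t,y}(X) X`. Cameron–Martin moves the
dependence of `P_t f` on its argument from the merely measurable `f` to a smooth density, and
differentiating gives `∇ P_t f(y) = k v(y)` with `k² = 1 / (e^{2t} - 1)`
(`hasDerivAt_ornsteinUhlenbeck_rotation`). A Gaussian Poincaré inequality with constant `π² / 4`
then bounds `Var (P_t f)` by `(π² / 4) k² E ‖v(Y)‖²` (`variance_ornsteinUhlenbeck_le`).

Conversely, for `g` with values in `[0, 1]`, the norm of `E g(X) X` is the correlation of `g` with a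
linear functional. Up to truncation this functional is an average of half-space indicators, so some
half-space has covariance at least about half the squared norm (`sq_norm_integral_smul_id_le`).
Taking `g = f_{t,y}` and integrating over `y` gives the theorem with `c = 2 / π²`. Integrability of
`M(f_{t,y})` comes from writing it as a countable supremum. -/

lemma integrable_exp_mul_norm_stdGaussian (K : ℝ) :
    Integrable (fun z => Real.exp (K * ‖z‖)) (stdGaussian (EuclideanSpace ℝ ι)) := by
  obtain ⟨C, hC, hint⟩ := IsGaussian.exists_integrable_exp_sq (stdGaussian (EuclideanSpace ℝ ι))
  refine (hint.const_mul (Real.exp (K ^ 2 / (4 * C)))).mono' (by fun_prop) (ae_of_all _ fun z => ?_)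
  rw [Real.norm_of_nonneg (Real.exp_pos _).le, ← Real.exp_add, Real.exp_le_exp]
  have h : K ^ 2 / (4 * C) + C * ‖z‖ ^ 2 - K * ‖z‖ = C * (‖z‖ - K / (2 * C)) ^ 2 := by
    field_simp; ring
  nlinarith [mul_nonneg hC.le (sq_nonneg (‖z‖ - K / (2 * C)))]

lemma integrable_exp_inner_stdGaussian (h : EuclideanSpace ℝ ι) (c : ℝ) :
    Integrable (fun z => Real.exp (inner ℝ z h - c)) (stdGaussian (EuclideanSpace ℝ ι)) := by
  simp_rw [Real.exp_sub, div_eq_mul_inv]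
  refine Integrable.mul_const ?_ _
  refine (integrable_exp_mul_norm_stdGaussian ‖h‖).mono' (by fun_prop) (ae_of_all _ fun z => ?_)
  rw [Real.norm_of_nonneg (Real.exp_pos _).le, Real.exp_le_exp, mul_comm]
  exact real_inner_le_norm z h

/-- The **Cameron–Martin formula** for the standard Gaussian measure. -/
lemma stdGaussian_map_add_const (h : EuclideanSpace ℝ ι) :
    (stdGaussian (EuclideanSpace ℝ ι)).map (· + h) =
      (stdGaussian (EuclideanSpace ℝ ι)).withDensity
        (fun z => ENNReal.ofReal (Real.exp (inner ℝ z h - ‖h‖ ^ 2 / 2))) := by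
  have hint := integrable_exp_inner_stdGaussian h (‖h‖ ^ 2 / 2)
  have : IsFiniteMeasure ((stdGaussian (EuclideanSpace ℝ ι)).withDensity
      (fun z => ENNReal.ofReal (Real.exp (inner ℝ z h - ‖h‖ ^ 2 / 2)))) :=
    isFiniteMeasure_withDensity_ofReal hint.2
  have : IsFiniteMeasure ((stdGaussian (EuclideanSpace ℝ ι)).map (· + h)) :=
    Measure.isFiniteMeasure_map _ _
  refine Measure.ext_of_charFun (funext fun t => ?_)
  rw [charFun_map_add_const, charFun_stdGaussian, charFun_apply,
    integral_withDensity_eq_integral_toReal_smul (by fun_prop) (by simp)]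
  simp_rw [ENNReal.toReal_ofReal (Real.exp_pos _).le]
  -- Density times character factors over coordinates into exponentials with complex parameters `h i
  -- + t i * I`, so the one-dimensional complex moment generating function suffices.
  have key (z : EuclideanSpace ℝ ι) :
      Real.exp (inner ℝ z h - ‖h‖ ^ 2 / 2) • Complex.exp (inner ℝ z t * Complex.I) =
        Complex.exp (-(‖h‖ : ℂ) ^ 2 / 2) *
          ∏ i, Complex.exp ((h i + t i * Complex.I) * z i) := by
    rw [Complex.real_smul, Complex.ofReal_exp, ← Complex.exp_add, ← Complex.exp_sum,
      ← Complex.exp_add, PiLp.inner_apply, PiLp.inner_apply]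
    congr 1
    simp only [RCLike.inner_apply, conj_trivial, add_mul, Finset.sum_add_distrib]
    push_cast
    rw [Finset.sum_mul]
    have : ∑ i, (t i : ℂ) * Complex.I * z i = ∑ i, (t i : ℂ) * z i * Complex.I :=
      Finset.sum_congr rfl fun i _ => by ring
    rw [this]
    ring
  simp_rw [key]
  rw [integral_const_mul, ← map_pi_eq_stdGaussian, integral_map (by fun_prop)
    (Continuous.aestronglyMeasurable (by fun_prop))]
  simp only []
  rw [integral_fintype_prod_eq_prod (μ := fun _ => gaussianReal 0 1)
    (f := fun i (x : ℝ) => Complex.exp ((h i + t i * Complex.I) * x))]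
  have hm (w : ℂ) : ∫ x : ℝ, Complex.exp (w * x) ∂(gaussianReal 0 1) = Complex.exp (w ^ 2 / 2) := by
    have := complexMGF_id_gaussianReal (μ := 0) (v := 1) w
    simpa [complexMGF] using this
  simp_rw [hm]
  rw [← Complex.exp_sum, ← Complex.exp_add, ← Complex.exp_add]
  congr 1
  have e1 : (‖h‖ : ℂ) ^ 2 = ∑ i, (h i : ℂ) ^ 2 := by
    rw [← Complex.ofReal_pow, EuclideanSpace.real_norm_sq_eq]; push_cast; rfl
  have e2 : (‖t‖ : ℂ) ^ 2 = ∑ i, (t i : ℂ) ^ 2 := by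
    rw [← Complex.ofReal_pow, EuclideanSpace.real_norm_sq_eq]; push_cast; rfl
  have e3 : ((inner ℝ h t : ℝ) : ℂ) = ∑ i, (h i : ℂ) * t i := by
    rw [PiLp.inner_apply]; push_cast; exact Finset.sum_congr rfl fun i _ => by simp [mul_comm]
  rw [e1, e2, e3, ← Finset.sum_div]
  have (i : ι) : ((h i : ℂ) + t i * Complex.I) ^ 2 =
      (h i : ℂ) ^ 2 - (t i : ℂ) ^ 2 + 2 * Complex.I * (h i * t i) := by
    linear_combination (t i : ℂ) ^ 2 * Complex.I_sq
  simp_rw [this, Finset.sum_add_distrib, Finset.sum_sub_distrib, ← Finset.mul_sum]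
  ring

lemma integral_add_const_stdGaussian (h : EuclideanSpace ℝ ι) {f : EuclideanSpace ℝ ι → ℝ}
    (hf : Measurable f) :
    ∫ z, f (z + h) ∂(stdGaussian (EuclideanSpace ℝ ι)) =
      ∫ z, f z * Real.exp (inner ℝ z h - ‖h‖ ^ 2 / 2) ∂(stdGaussian (EuclideanSpace ℝ ι)) := by
  rw [← integral_map (φ := (· + h)) (by fun_prop) hf.aestronglyMeasurable,
    stdGaussian_map_add_const, integral_withDensity_eq_integral_toReal_smul (by fun_prop) (by simp)]
  simp_rw [ENNReal.toReal_ofReal (Real.exp_pos _).le, smul_eq_mul, mul_comm]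

end CameronMartin

/-! ### Differentiation along a Gaussian shift -/

section Derivative

variable {ι : Type*} [Fintype ι]

lemma integrable_smul_id_stdGaussian {g : EuclideanSpace ℝ ι → ℝ} (hg : Measurable g)
    (hg1 : ∀ z, |g z| ≤ 1) :
    Integrable (fun z => g z • z) (stdGaussian (EuclideanSpace ℝ ι)) :=
  IsGaussian.integrable_fun_id.mono (by fun_prop) <| ae_of_all _ fun z => by
    rw [norm_smul, Real.norm_eq_abs]
    exact mul_le_of_le_one_left (norm_nonneg z) (hg1 z)

/-- At a zero of `h` the density is `1` and the correction from `‖h‖ ^ 2` has zero derivative, so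
only the first moment of `g` survives. -/
lemma hasDerivAt_integral_mul_exp_inner_stdGaussian {g : EuclideanSpace ℝ ι → ℝ}
    (hg : Measurable g) (hg1 : ∀ z, |g z| ≤ 1) {h h' : ℝ → EuclideanSpace ℝ ι} {K θ₀ : ℝ}
    (hd : ∀ θ, HasDerivAt h (h' θ) θ) (hK : ∀ θ, ‖h θ‖ ≤ K) (hK' : ∀ θ, ‖h' θ‖ ≤ K)
    (h0 : h θ₀ = 0) :
    HasDerivAt (fun θ => ∫ z, g z * Real.exp (inner ℝ z (h θ) - ‖h θ‖ ^ 2 / 2)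
        ∂(stdGaussian (EuclideanSpace ℝ ι)))
      (inner ℝ (∫ z, g z • z ∂(stdGaussian (EuclideanSpace ℝ ι))) (h' θ₀)) θ₀ := by
  have hK0 : 0 ≤ K := (norm_nonneg _).trans (hK 0)
  have key := hasDerivAt_integral_of_dominated_loc_of_deriv_le
    (μ := stdGaussian (EuclideanSpace ℝ ι)) (x₀ := θ₀) (s := Set.univ) Filter.univ_mem
    (F := fun θ z => g z * Real.exp (inner ℝ z (h θ) - ‖h θ‖ ^ 2 / 2))
    (F' := fun θ z => g z * (Real.exp (inner ℝ z (h θ) - ‖h θ‖ ^ 2 / 2) *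
      (inner ℝ z (h' θ) - inner ℝ (h θ) (h' θ))))
    (bound := fun z => Real.exp (2 * K * ‖z‖) * Real.exp (K ^ 2))
    (Filter.Eventually.of_forall fun θ => by fun_prop) ?_ (by fun_prop) ?_
    ((integrable_exp_mul_norm_stdGaussian _).mul_const _) ?_
  · refine key.2.congr_deriv ?_
    have hL := (innerSL ℝ (h' θ₀)).integral_comp_comm (integrable_smul_id_stdGaussian hg hg1)
    simp only [innerSL_apply_apply] at hL
    rw [real_inner_comm (h' θ₀) (∫ z, g z • z ∂_), ← hL]
    simp [h0, inner_smul_right, real_inner_comm (h' θ₀)]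
  · refine (integrable_exp_inner_stdGaussian (h θ₀) (‖h θ₀‖ ^ 2 / 2)).mono (by fun_prop)
      (ae_of_all _ fun z => ?_)
    rw [norm_mul, Real.norm_eq_abs]
    exact mul_le_of_le_one_left (norm_nonneg _) (hg1 z)
  · refine ae_of_all _ fun z θ _ => ?_
    rw [norm_mul, norm_mul, Real.norm_eq_abs, Real.norm_of_nonneg (Real.exp_pos _).le,
      ← Real.exp_add]
    have b1 : |inner ℝ z (h' θ) - inner ℝ (h θ) (h' θ)| ≤ K * ‖z‖ + K ^ 2 := by
      refine (abs_sub _ _).trans (add_le_add ?_ ?_)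
      · refine (abs_real_inner_le_norm _ _).trans ?_
        rw [mul_comm]
        exact mul_le_mul_of_nonneg_right (hK' θ) (norm_nonneg z)
      · refine (abs_real_inner_le_norm _ _).trans ?_
        rw [sq]
        exact mul_le_mul (hK θ) (hK' θ) (norm_nonneg _) hK0
    have b2 : inner ℝ z (h θ) - ‖h θ‖ ^ 2 / 2 ≤ K * ‖z‖ := by
      have := real_inner_le_norm z (h θ)
      have := mul_le_mul_of_nonneg_right (hK θ) (norm_nonneg z)
      nlinarith [sq_nonneg ‖h θ‖]
    -- The linear factor from the derivative is absorbed into a second exponential, whence the `2 *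
    -- K` in the dominating function.
    have b3 := Real.add_one_le_exp (K * ‖z‖ + K ^ 2)
    calc _ ≤ 1 * (Real.exp (K * ‖z‖) * Real.exp (K * ‖z‖ + K ^ 2)) := by
          refine mul_le_mul (hg1 z) ?_ (by positivity) zero_le_one
          refine mul_le_mul (Real.exp_le_exp.2 b2) ?_ (norm_nonneg _) (Real.exp_pos _).le
          rw [Real.norm_eq_abs]; linarith
      _ = _ := by rw [one_mul, ← Real.exp_add]; congr 1; ring
  · refine ae_of_all _ fun z θ _ => ?_
    have hn : HasDerivAt (fun θ => ‖h θ‖ ^ 2 / 2) (inner ℝ (h θ) (h' θ)) θ := by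
      simpa using ((hd θ).norm_sq).div_const 2
    have hi : HasDerivAt (fun θ => inner ℝ z (h θ)) (inner ℝ z (h' θ)) θ := by
      simpa using (hasDerivAt_const θ z).inner ℝ (hd θ)
    exact ((hi.sub hn).exp).const_mul (g z)

end Derivative

/-! ### The gradient of the semigroup -/

namespace GaussianNoise

variable {n : ℕ} {f : EuclideanSpace ℝ (Fin n) → ℝ} {t : ℝ}

/-- The first moment `E f_{t,y}(X) X`, which is proportional to the gradient of `P_t f` at `y`. -/
noncomputable def firstMoment (t : ℝ) (f : EuclideanSpace ℝ (Fin n) → ℝ)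
    (y : EuclideanSpace ℝ (Fin n)) : EuclideanSpace ℝ (Fin n) :=
  ∫ z, scaleShift t y f z • z ∂(gammaMeasure n)

lemma one_sub_exp_pos (ht : 0 < t) : 0 < 1 - Real.exp (-2 * t) := by
  have : Real.exp (-2 * t) < 1 := Real.exp_zero ▸ Real.exp_lt_exp.2 (by linarith)
  linarith

lemma measurable_scaleShift_uncurry (hf : Measurable f) :
    Measurable (fun p : EuclideanSpace ℝ (Fin n) × EuclideanSpace ℝ (Fin n) =>
      scaleShift t p.1 f p.2) := by
  unfold scaleShift
  fun_prop

lemma measurable_scaleShift (hf : Measurable f) (y : EuclideanSpace ℝ (Fin n)) :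
    Measurable (scaleShift t y f) := by
  unfold scaleShift
  fun_prop

lemma measurable_firstMoment (hf : Measurable f) : Measurable (firstMoment t f) :=
  (StronglyMeasurable.integral_prod_right (f := fun y z => scaleShift t y f z • z)
    ((measurable_scaleShift_uncurry hf).smul measurable_snd).stronglyMeasurable).measurable

lemma norm_firstMoment_le (hf1 : ∀ x, |f x| ≤ 1) (y : EuclideanSpace ℝ (Fin n)) :
    ‖firstMoment t f y‖ ≤ ∫ z, ‖z‖ ∂(gammaMeasure n) := by
  refine norm_integral_le_of_norm_le IsGaussian.integrable_fun_id.norm (ae_of_all _ fun z => ?_)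
  rw [norm_smul, Real.norm_eq_abs]
  exact mul_le_of_le_one_left (norm_nonneg z) (hf1 _)

/-- Moving the base point from `p θ` to `p τ` amounts to shifting the noise by `(r / s) • (p τ - p
θ)`, which vanishes at `τ = θ`; the previous derivative formula then applies to `scaleShift t (p θ)
f`. -/
lemma hasDerivAt_ornsteinUhlenbeck_rotation (ht : 0 < t) (hf : Measurable f)
    (hf1 : ∀ x, |f x| ≤ 1) (x y : EuclideanSpace ℝ (Fin n)) (θ : ℝ) :
    HasDerivAt (fun θ => ornsteinUhlenbeck t f (Real.cos θ • x + Real.sin θ • y))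
      (Real.exp (-t) / √(1 - Real.exp (-2 * t)) *
        inner ℝ (firstMoment t f (Real.cos θ • x + Real.sin θ • y))
          (-Real.sin θ • x + Real.cos θ • y)) θ := by
  set s := √(1 - Real.exp (-2 * t)) with hs
  set r := Real.exp (-t) with hr
  have hs0 : 0 < s := Real.sqrt_pos.2 (one_sub_exp_pos ht)
  have hr0 : 0 < r := Real.exp_pos _
  set p : ℝ → EuclideanSpace ℝ (Fin n) := fun θ => Real.cos θ • x + Real.sin θ • y with hp
  have hpd (θ : ℝ) : HasDerivAt p (-Real.sin θ • x + Real.cos θ • y) θ :=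
    ((Real.hasDerivAt_cos θ).smul_const x).add ((Real.hasDerivAt_sin θ).smul_const y)
  have hb (a b : ℝ) (ha : |a| ≤ 1) (hb : |b| ≤ 1) : ‖a • x + b • y‖ ≤ ‖x‖ + ‖y‖ := by
    refine (norm_add_le _ _).trans (add_le_add ?_ ?_) <;> rw [norm_smul, Real.norm_eq_abs]
    · exact mul_le_of_le_one_left (norm_nonneg _) ha
    · exact mul_le_of_le_one_left (norm_nonneg _) hb
  have hpb (θ : ℝ) : ‖p θ‖ ≤ ‖x‖ + ‖y‖ := hb _ _ (Real.abs_cos_le_one θ) (Real.abs_sin_le_one θ)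
  have hpb' (θ : ℝ) : ‖-Real.sin θ • x + Real.cos θ • y‖ ≤ ‖x‖ + ‖y‖ :=
    hb _ _ (by rw [abs_neg]; exact Real.abs_sin_le_one θ) (Real.abs_cos_le_one θ)
  have key := hasDerivAt_integral_mul_exp_inner_stdGaussian
    (measurable_scaleShift (t := t) hf (p θ)) (fun z => hf1 _)
    (h := fun τ => (r / s) • (p τ - p θ))
    (h' := fun τ => (r / s) • (-Real.sin τ • x + Real.cos τ • y))
    (K := (r / s) * (2 * (‖x‖ + ‖y‖))) (θ₀ := θ)
    (fun τ => ((hpd τ).sub_const (p θ)).fun_const_smul (r / s)) (fun τ => ?_) (fun τ => ?_) (by simp)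
  · rw [inner_smul_right] at key
    refine key.congr_of_eventuallyEq (Filter.Eventually.of_forall fun τ => ?_)
    simp only []
    rw [← integral_add_const_stdGaussian _ (measurable_scaleShift hf _)]
    unfold ornsteinUhlenbeck scaleShift
    refine integral_congr_ae (ae_of_all _ fun z => congrArg f ?_)
    change r • p τ + s • z = s • (z + (r / s) • (p τ - p θ)) + r • p θ
    rw [smul_add s z, smul_smul s, show s * (r / s) = r by field_simp, smul_sub]
    abel
  · rw [norm_smul, Real.norm_of_nonneg (by positivity)]
    refine mul_le_mul_of_nonneg_left ?_ (by positivity)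
    linarith [norm_sub_le (p τ) (p θ), hpb τ, hpb θ]
  · rw [norm_smul, Real.norm_of_nonneg (by positivity)]
    refine mul_le_mul_of_nonneg_left ?_ (by positivity)
    linarith [hpb' τ, norm_nonneg x, norm_nonneg y]

end GaussianNoise

/-! ### The Poincaré inequality by rotation -/

lemma sq_integral_le_measureReal_mul_integral_sq {α : Type*} [MeasurableSpace α] {μ : Measure α}
    [IsFiniteMeasure μ] {u : α → ℝ} (hu : MemLp u 2 μ) :
    (∫ x, u x ∂μ) ^ 2 ≤ μ.real Set.univ * ∫ x, u x ^ 2 ∂μ := by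
  set L := μ.real Set.univ
  set m := ∫ x, u x ∂μ
  have hi : Integrable u μ := hu.integrable one_le_two
  have h0 : 0 ≤ ∫ x, (L * u x - m) ^ 2 ∂μ := integral_nonneg fun x => sq_nonneg _
  have h1 : ∫ x, (L * u x - m) ^ 2 ∂μ = L ^ 2 * ∫ x, u x ^ 2 ∂μ - L * m ^ 2 := by
    have : ∀ x, (L * u x - m) ^ 2 = L ^ 2 * u x ^ 2 - 2 * L * m * u x + m ^ 2 := fun x => by ring
    simp_rw [this]
    have hA : Integrable (fun x => L ^ 2 * u x ^ 2 - 2 * L * m * u x) μ :=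
      (hu.integrable_sq.const_mul _).sub (hi.const_mul _)
    rw [integral_add hA (integrable_const _),
      integral_sub (hu.integrable_sq.const_mul _) (hi.const_mul _), integral_const_mul,
      integral_const_mul, integral_const, smul_eq_mul]
    ring
  rcases (measureReal_nonneg : 0 ≤ L).eq_or_lt with hL | hL
  · have : μ = 0 := by
      rwa [eq_comm, measureReal_eq_zero_iff, Measure.measure_univ_eq_zero] at hL
    simp [m, this]
  · rw [h1] at h0
    nlinarith

section

variable {E : Type*} [NormedAddCommGroup E] [InnerProductSpace ℝ E] [FiniteDimensional ℝ E]
  [MeasurableSpace E] [BorelSpace E]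

lemma integral_inner_sq_stdGaussian (w : E) :
    ∫ x, (inner ℝ w x) ^ 2 ∂(stdGaussian E) = ‖w‖ ^ 2 := by
  have h := variance_dual_stdGaussian (innerSL ℝ w)
  rw [variance_of_integral_eq_zero (by fun_prop) (integral_strongDual_stdGaussian _)] at h
  simpa [innerSL_apply_apply, innerSL_apply_norm] using h

/-- The product measure is rotation invariant, so the rotated pair may be replaced by two
independent Gaussians; integrating the second one first leaves `‖v x‖ ^ 2`. -/
lemma integral_inner_rotation_sq_stdGaussian {v : E → E} (hv : Measurable v) {V : ℝ}
    (hV : ∀ x, ‖v x‖ ≤ V) (θ : ℝ) :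
    ∫ p, (inner ℝ (v (Real.cos θ • p.1 + Real.sin θ • p.2))
        (-Real.sin θ • p.1 + Real.cos θ • p.2)) ^ 2 ∂((stdGaussian E).prod (stdGaussian E)) =
      ∫ x, ‖v x‖ ^ 2 ∂(stdGaussian E) := by
  have hrot := IsGaussian.map_rotation_eq_self (μ := stdGaussian E) integral_id_stdGaussian θ
  have hmeas : Measurable fun p : E × E => (inner ℝ (v p.1) p.2) ^ 2 := by fun_prop
  have hV0 : 0 ≤ V := (norm_nonneg _).trans (hV 0)
  have hint : Integrable (fun p : E × E => (inner ℝ (v p.1) p.2) ^ 2)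
      ((stdGaussian E).prod (stdGaussian E)) := by
    have h2 : Integrable (fun x : E => V ^ 2 * ‖x‖ ^ 2) (stdGaussian E) :=
      (IsGaussian.memLp_two_id.integrable_norm_pow two_ne_zero).const_mul _
    refine (h2.comp_snd (stdGaussian E)).mono' hmeas.aestronglyMeasurable (ae_of_all _ fun p => ?_)
    rw [Real.norm_of_nonneg (sq_nonneg _), ← mul_pow, ← sq_abs]
    refine pow_le_pow_left₀ (abs_nonneg _) ((abs_real_inner_le_norm _ _).trans ?_) 2
    exact mul_le_mul_of_nonneg_right (hV _) (norm_nonneg _)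
  have h1 := integral_map (μ := (stdGaussian E).prod (stdGaussian E))
    (φ := ContinuousLinearMap.rotation θ) (by fun_prop) hmeas.aestronglyMeasurable
  rw [hrot] at h1
  simp only [ContinuousLinearMap.rotation_apply] at h1
  rw [← h1, integral_prod _ hint]
  simp_rw [integral_inner_sq_stdGaussian]

end

namespace GaussianNoise

variable {n : ℕ} {f : EuclideanSpace ℝ (Fin n) → ℝ} {t : ℝ}

lemma abs_ornsteinUhlenbeck_le (hf1 : ∀ x, |f x| ≤ 1) (x : EuclideanSpace ℝ (Fin n)) :
    |ornsteinUhlenbeck t f x| ≤ 1 := by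
  have := norm_integral_le_of_norm_le_const (μ := gammaMeasure n) (C := 1)
    (f := fun z => f (Real.exp (-t) • x + √(1 - Real.exp (-2 * t)) • z))
    (ae_of_all _ fun z => hf1 _)
  simpa [ornsteinUhlenbeck] using this

lemma measurable_ornsteinUhlenbeck (hf : Measurable f) : Measurable (ornsteinUhlenbeck t f) :=
  (StronglyMeasurable.integral_prod_right
    (f := fun x z => f (Real.exp (-t) • x + √(1 - Real.exp (-2 * t)) • z))
    (Measurable.stronglyMeasurable (by fun_prop))).measurable

/-- A **Poincaré inequality** for `P_t f`, with Pisier's rotation argument. -/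
lemma variance_ornsteinUhlenbeck_le (ht : 0 < t) (hf : Measurable f) (hf1 : ∀ x, |f x| ≤ 1) :
    Var[ornsteinUhlenbeck t f; gammaMeasure n] ≤
      (Real.pi / 2) ^ 2 * (Real.exp (-t) / √(1 - Real.exp (-2 * t))) ^ 2 *
        ∫ y, ‖firstMoment t f y‖ ^ 2 ∂(gammaMeasure n) := by
  set F := ornsteinUhlenbeck t f with hF
  set γ := gammaMeasure n with hγ
  set k := Real.exp (-t) / √(1 - Real.exp (-2 * t)) with hk
  set v := firstMoment t f with hv
  set V := ∫ z, ‖z‖ ∂γ with hV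
  have hvV : ∀ x, ‖v x‖ ≤ V := norm_firstMoment_le hf1
  have hvm : Measurable v := measurable_firstMoment hf
  have hFm : Measurable F := measurable_ornsteinUhlenbeck hf
  have hF1 : ∀ x, |F x| ≤ 1 := abs_ornsteinUhlenbeck_le hf1
  have hV0 : 0 ≤ V := (norm_nonneg _).trans (hvV 0)
  have hpi : 0 ≤ Real.pi / 2 := by positivity
  let ν : Measure ℝ := volume.restrict (Set.Ioc 0 (Real.pi / 2))
  have hν : ν.real Set.univ = Real.pi / 2 := by simp [ν, hpi]
  let u : EuclideanSpace ℝ (Fin n) × EuclideanSpace ℝ (Fin n) → ℝ → ℝ := fun p θ =>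
    k * inner ℝ (v (Real.cos θ • p.1 + Real.sin θ • p.2))
      (-Real.sin θ • p.1 + Real.cos θ • p.2)
  have hum : Measurable (Function.uncurry u) := by
    simp only [u, Function.uncurry_def]
    fun_prop
  have hub (p) (θ) : |u p θ| ≤ |k| * (V * (‖p.1‖ + ‖p.2‖)) := by
    rw [abs_mul]
    refine mul_le_mul_of_nonneg_left ((abs_real_inner_le_norm _ _).trans ?_) (abs_nonneg _)
    refine mul_le_mul (hvV _) ?_ (norm_nonneg _) hV0
    refine (norm_add_le _ _).trans (add_le_add ?_ ?_) <;> rw [norm_smul, Real.norm_eq_abs]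
    · exact mul_le_of_le_one_left (norm_nonneg _) (by rw [abs_neg]; exact Real.abs_sin_le_one θ)
    · exact mul_le_of_le_one_left (norm_nonneg _) (Real.abs_cos_le_one θ)
  have hLp (p) : MemLp (u p) 2 ν :=
    MemLp.of_bound (hum.of_uncurry_left).aestronglyMeasurable _ (ae_of_all _ fun θ => hub p θ)
  -- The quarter circle `cos θ • p.1 + sin θ • p.2` joins `p.1` to `p.2`.
  have hftc (p : EuclideanSpace ℝ (Fin n) × EuclideanSpace ℝ (Fin n)) :
      ∫ θ, u p θ ∂ν = F p.2 - F p.1 := by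
    have := intervalIntegral.integral_eq_sub_of_hasDerivAt (a := 0) (b := Real.pi / 2)
      (fun θ _ => hasDerivAt_ornsteinUhlenbeck_rotation ht hf hf1 p.1 p.2 θ)
      ((intervalIntegrable_iff_integrableOn_Ioc_of_le hpi).2 ((hLp p).integrable one_le_two))
    rw [intervalIntegral.integral_of_le hpi] at this
    simp only [Real.cos_pi_div_two, Real.sin_pi_div_two, Real.cos_zero, Real.sin_zero, zero_smul,
      one_smul, zero_add, add_zero] at this
    exact this
  have hpt (p : EuclideanSpace ℝ (Fin n) × EuclideanSpace ℝ (Fin n)) :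
      (F p.2 - F p.1) ^ 2 ≤ Real.pi / 2 * ∫ θ, u p θ ^ 2 ∂ν := by
    rw [← hftc, ← hν]
    exact sq_integral_le_measureReal_mul_integral_sq (hLp p)
  have hint : Integrable (Function.uncurry fun p θ => u p θ ^ 2) ((γ.prod γ).prod ν) := by
    have hsq : Integrable (fun x : EuclideanSpace ℝ (Fin n) => ‖x‖ ^ 2) γ :=
      IsGaussian.memLp_two_id.integrable_norm_pow two_ne_zero
    have hb : Integrable (fun p : EuclideanSpace ℝ (Fin n) × EuclideanSpace ℝ (Fin n) =>
        2 * (|k| * V) ^ 2 * (‖p.1‖ ^ 2 + ‖p.2‖ ^ 2)) (γ.prod γ) :=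
      ((hsq.comp_fst γ).add (hsq.comp_snd γ)).const_mul _
    refine (hb.comp_fst ν).mono' (hum.pow_const 2).aestronglyMeasurable (ae_of_all _ fun q => ?_)
    simp only [Function.uncurry]
    rw [Real.norm_of_nonneg (sq_nonneg _), ← sq_abs]
    refine (pow_le_pow_left₀ (abs_nonneg _) (hub q.1 q.2) 2).trans ?_
    have : 0 ≤ (|k| * V) ^ 2 * (‖q.1.1‖ - ‖q.1.2‖) ^ 2 := by positivity
    linarith
  have hdiff : Integrable (fun p : EuclideanSpace ℝ (Fin n) × EuclideanSpace ℝ (Fin n) =>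
      (F p.2 - F p.1) ^ 2) (γ.prod γ) := by
    refine Integrable.of_bound (Measurable.aestronglyMeasurable (by fun_prop)) 4
      (ae_of_all _ fun p => ?_)
    rw [Real.norm_of_nonneg (sq_nonneg _)]
    nlinarith [abs_le.1 (hF1 p.1), abs_le.1 (hF1 p.2)]
  calc Var[F; γ] = ∫ x, Var[F; γ] ∂γ := by simp
    -- For each fixed `x`, variance is at most the second moment about `F x`. This gives up a factor
    -- `2`, which only affects `c`.
    _ ≤ ∫ x, ∫ y, (F y - F x) ^ 2 ∂γ ∂γ := by
        refine integral_mono (integrable_const _) hdiff.integral_prod_left fun x => ?_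
        simp only []
        rw [← variance_sub_const hFm.aestronglyMeasurable (F x)]
        exact variance_le_expectation_sq (by fun_prop)
    _ = ∫ p, (F p.2 - F p.1) ^ 2 ∂(γ.prod γ) := (integral_prod _ hdiff).symm
    _ ≤ ∫ p, Real.pi / 2 * ∫ θ, u p θ ^ 2 ∂ν ∂(γ.prod γ) :=
        integral_mono hdiff (hint.integral_prod_left.const_mul _) hpt
    _ = Real.pi / 2 * ∫ θ, ∫ p, u p θ ^ 2 ∂(γ.prod γ) ∂ν := by
        rw [integral_const_mul, integral_integral_swap hint]
    _ = _ := by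
        simp only [u, mul_pow, integral_const_mul]
        simp_rw [hγ, integral_inner_rotation_sq_stdGaussian hvm hvV]
        rw [integral_const, hν, smul_eq_mul]
        ring

end GaussianNoise

/-! ### From linear correlation to half-spaces -/

lemma indicator_one_mem_Icc {Ω : Type*} (A : Set Ω) (x : Ω) :
    A.indicator (fun _ => (1 : ℝ)) x ∈ Set.Icc (0 : ℝ) 1 := by
  by_cases hx : x ∈ A <;> simp [hx]

section

variable {Ω : Type*} [MeasurableSpace Ω] {μ : Measure Ω} [IsProbabilityMeasure μ]

lemma integral_mem_Icc_zero_one {X : Ω → ℝ} (hX : ∀ x, X x ∈ Set.Icc (0 : ℝ) 1) :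
    ∫ x, X x ∂μ ∈ Set.Icc (0 : ℝ) 1 := by
  refine ⟨integral_nonneg fun x => (hX x).1, (le_abs_self _).trans ?_⟩
  have := norm_integral_le_of_norm_le_const (μ := μ) (f := X) (C := 1)
    (ae_of_all _ fun x => by rw [Real.norm_of_nonneg (hX x).1]; exact (hX x).2)
  simpa using this

lemma abs_sub_integral_le_one {X : Ω → ℝ} (hX : ∀ x, X x ∈ Set.Icc (0 : ℝ) 1) (x : Ω) :
    |X x - ∫ x, X x ∂μ| ≤ 1 := by
  obtain ⟨h1, h2⟩ := integral_mem_Icc_zero_one (μ := μ) hX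
  obtain ⟨h3, h4⟩ := hX x
  exact abs_le.2 ⟨by linarith, by linarith⟩

lemma abs_covariance_le_one {X Y : Ω → ℝ} (hX : ∀ x, X x ∈ Set.Icc (0 : ℝ) 1)
    (hY : ∀ x, Y x ∈ Set.Icc (0 : ℝ) 1) : |cov[X, Y; μ]| ≤ 1 := by
  have := norm_integral_le_of_norm_le_const (μ := μ) (C := 1)
    (f := fun x => (X x - ∫ x, X x ∂μ) * (Y x - ∫ x, Y x ∂μ)) (ae_of_all _ fun x => by
      rw [norm_mul]
      exact mul_le_one₀ (abs_sub_integral_le_one hX x) (norm_nonneg _)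
        (abs_sub_integral_le_one hY x))
  simpa [covariance] using this

lemma covariance_indicator_one {X : Ω → ℝ} (hX : Integrable X μ) {A : Set Ω}
    (hA : MeasurableSet A) :
    cov[X, A.indicator (fun _ => (1 : ℝ)); μ] =
      ∫ x, (X x - ∫ x, X x ∂μ) * A.indicator (fun _ => (1 : ℝ)) x ∂μ := by
  have hw : Integrable (fun x => X x - ∫ x, X x ∂μ) μ := hX.sub (integrable_const _)
  have h0 : ∫ x, (X x - ∫ x, X x ∂μ) ∂μ = 0 := by
    rw [integral_sub hX (integrable_const _)]; simp
  have h1 : Integrable (fun x => (X x - ∫ x, X x ∂μ) * A.indicator (fun _ => (1 : ℝ)) x) μ := by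
    refine hw.mul_bdd (c := 1) ((measurable_const.indicator hA).aestronglyMeasurable)
      (ae_of_all _ fun x => ?_)
    obtain ⟨h, h'⟩ := indicator_one_mem_Icc A x
    rwa [Real.norm_of_nonneg h]
  simp_rw [covariance, mul_sub]
  rw [integral_sub h1 (hw.mul_const _), integral_mul_const, h0]
  simp

end

/-- The integral over thresholds `b ∈ (-B, B]` of the indicator of `b ≤ u` is a truncation of
`u + B`. -/
lemma abs_add_sub_setIntegral_indicator_le {B : ℝ} (hB : 0 < B) (u : ℝ) :
    |u + B - ∫ b in Set.Ioc (-B) B, (Set.Iic u).indicator (fun _ => (1 : ℝ)) b| ≤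
      u ^ 2 / (4 * B) := by
  rw [setIntegral_indicator measurableSet_Iic, Set.Ioc_inter_Iic, setIntegral_const,
    Real.volume_real_Ioc, smul_eq_mul, mul_one, le_div_iff₀ (by positivity)]
  -- The error vanishes for `|u| ≤ B`; otherwise it is `|u| - B`, and `(|u| - 2B)² ≥ 0` gives the
  -- bound.
  rcases le_total u B with h | h
  · rw [min_eq_right h]
    rcases le_total (u - -B) 0 with h' | h'
    · rw [max_eq_right h', abs_of_nonpos (by linarith)]
      nlinarith [sq_nonneg (u + 2 * B)]
    · rw [max_eq_left h']
      simp only [sub_neg_eq_add, sub_self, abs_zero, zero_mul]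
      positivity
  · rw [min_eq_left h, max_eq_left (by linarith), abs_of_nonneg (by linarith)]
    nlinarith [sq_nonneg (u - 2 * B)]

namespace GaussianNoise

variable {n : ℕ} {g : EuclideanSpace ℝ (Fin n) → ℝ}

lemma bddAbove_covariance_halfSpaces (hg1 : ∀ x, g x ∈ Set.Icc (0 : ℝ) 1) :
    BddAbove {r | ∃ A ∈ halfSpaces n, r = cov[g, A.indicator (fun _ => (1 : ℝ)); gammaMeasure n]} :=
  ⟨1, by
    rintro r ⟨A, -, rfl⟩
    exact (le_abs_self _).trans (abs_covariance_le_one hg1 (indicator_one_mem_Icc A))⟩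

lemma covariance_le_halfSpaceCorrelation (hg1 : ∀ x, g x ∈ Set.Icc (0 : ℝ) 1)
    (a : EuclideanSpace ℝ (Fin n)) (b : ℝ) :
    cov[g, {x | inner ℝ x a ≤ b}.indicator (fun _ => (1 : ℝ)); gammaMeasure n] ≤
      halfSpaceCorrelation g :=
  le_csSup (bddAbove_covariance_halfSpaces hg1) ⟨_, ⟨a, b, rfl⟩, rfl⟩

/-- With `a = 0` and `b = 0` the half-space is everything, and its covariance is zero. -/
lemma halfSpaceCorrelation_nonneg (hg1 : ∀ x, g x ∈ Set.Icc (0 : ℝ) 1) :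
    0 ≤ halfSpaceCorrelation g := by
  simpa using covariance_le_halfSpaceCorrelation hg1 0 0

/-- Correlation with a linear functional forces correlation with one of its half-spaces. -/
lemma sq_norm_integral_smul_id_le (hg : Measurable g) (hg1 : ∀ x, g x ∈ Set.Icc (0 : ℝ) 1) :
    ‖∫ z, g z • z ∂(gammaMeasure n)‖ ^ 2 / 2 ≤ halfSpaceCorrelation g := by
  set γ := gammaMeasure n with hγ
  set v := ∫ z, g z • z ∂γ with hv
  set M := halfSpaceCorrelation g with hM
  rcases eq_or_ne v 0 with h0 | h0
  · simpa [h0] using halfSpaceCorrelation_nonneg hg1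
  have hv0 : 0 < ‖v‖ := norm_pos_iff.2 h0
  set a := ‖v‖⁻¹ • v with ha
  have ha1 : ‖a‖ = 1 := by rw [ha, norm_smul, norm_inv, norm_norm, inv_mul_cancel₀ hv0.ne']
  have hva : inner ℝ a v = ‖v‖ := by
    rw [ha, real_inner_smul_left, real_inner_self_eq_norm_sq]; field_simp
  -- This truncation level optimises the final bound `‖v‖ ≤ 2 * B * M + 1 / (4 * B)`: the error term
  -- becomes `‖v‖ / 2`.
  set B := 1 / (2 * ‖v‖) with hBdef
  have hB : 0 < B := by positivity
  have habs : ∀ x, |g x| ≤ 1 := fun x => by rw [abs_of_nonneg (hg1 x).1]; exact (hg1 x).2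
  have hgi : Integrable g γ := Integrable.of_bound hg.aestronglyMeasurable 1 (ae_of_all _ habs)
  set m := ∫ x, g x ∂γ with hm
  set w := fun x => g x - m with hw
  have hw1 (x) : |w x| ≤ 1 := abs_sub_integral_le_one hg1 x
  have hwm : Measurable w := hg.sub_const m
  have hwi : Integrable w γ := hgi.sub (integrable_const _)
  let ν : Measure ℝ := volume.restrict (Set.Ioc (-B) B)
  let H : ℝ → ℝ := fun u => ∫ b, (Set.Iic u).indicator (fun _ => (1 : ℝ)) b ∂ν
  have hset : MeasurableSet {q : EuclideanSpace ℝ (Fin n) × ℝ | q.2 ≤ inner ℝ a q.1} :=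
    measurableSet_le (by fun_prop) (by fun_prop)
  let k : EuclideanSpace ℝ (Fin n) → ℝ → ℝ := fun x b =>
    w x * (Set.Iic (inner ℝ a x)).indicator (fun _ => (1 : ℝ)) b
  have hk : Integrable (Function.uncurry k) (γ.prod ν) := by
    refine Integrable.of_bound (C := 1) (Measurable.aestronglyMeasurable ?_)
      (ae_of_all _ fun q => ?_)
    · exact (hwm.comp measurable_fst).mul (measurable_const.indicator hset)
    · simp only [Function.uncurry, k]
      rw [norm_mul]
      obtain ⟨h, h'⟩ := indicator_one_mem_Icc (Set.Iic (inner ℝ a q.1)) q.2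
      exact mul_le_one₀ (hw1 _) (norm_nonneg _) (by rwa [Real.norm_of_nonneg h])
  have hswap : ∫ x, w x * H (inner ℝ a x) ∂γ = ∫ b, ∫ x, k x b ∂γ ∂ν := by
    rw [← integral_integral_swap hk]
    simp only [k, H, integral_const_mul]
  have hcov (b : ℝ) : ∫ x, k x b ∂γ ≤ M := by
    -- The layers are upper half-spaces `b ≤ ⟨a, x⟩`; negating both parameters puts them in the
    -- required form.
    refine le_trans (le_of_eq ?_) (covariance_le_halfSpaceCorrelation hg1 (-a) (-b))
    rw [covariance_indicator_one hgi (measurableSet_le (by fun_prop) (by fun_prop))]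
    refine integral_congr_ae (ae_of_all _ fun x => ?_)
    simp only [k, Set.indicator_apply, Set.mem_Iic, Set.mem_ofPred_eq, inner_neg_right, neg_le_neg_iff,
      real_inner_comm x a]
    rfl
  have hupper : ∫ x, w x * H (inner ℝ a x) ∂γ ≤ 2 * B * M := by
    rw [hswap]
    calc _ ≤ ∫ _b, M ∂ν := integral_mono hk.integral_prod_right (integrable_const _) hcov
      _ = 2 * B * M := by
        rw [integral_const, smul_eq_mul, measureReal_restrict_apply_univ, Real.volume_real_Ioc,
          max_eq_left (by linarith)]
        ring
  have hwa : Integrable (fun x => w x * inner ℝ a x) γ :=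
    ((innerSL ℝ a).integrable_comp IsGaussian.integrable_fun_id).bdd_mul (c := 1)
      hwm.aestronglyMeasurable (ae_of_all _ hw1)
  have hwH : Integrable (fun x => w x * H (inner ℝ a x)) γ := by
    have := hk.integral_prod_left
    simpa only [Function.uncurry, k, H, integral_const_mul] using this
  -- The offset `B` costs nothing because `w` has mean zero.
  have hmain : ∫ x, w x * (inner ℝ a x + B) ∂γ = ‖v‖ := by
    have e1 : ∫ x, w x * inner ℝ a x ∂γ = ‖v‖ := by
      have hga := integrable_smul_id_stdGaussian hg habs
      have e2 := (innerSL ℝ a).integral_comp_comm hga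
      have e3 := integral_strongDual_stdGaussian (innerSL ℝ a)
      simp only [innerSL_apply_apply, inner_smul_right] at e2 e3
      have hga' : Integrable (fun x => g x * inner ℝ a x) γ := by
        simpa [innerSL_apply_apply, inner_smul_right] using (innerSL ℝ a).integrable_comp hga
      have hai : Integrable (fun x => m * inner ℝ a x) γ :=
        ((innerSL ℝ a).integrable_comp IsGaussian.integrable_fun_id).const_mul m
      simp only [hw, sub_mul]
      rw [integral_sub hga' hai, integral_const_mul, e3, mul_zero, sub_zero, e2, hva]
    have e4 : ∫ x, w x ∂γ = 0 := by
      rw [hw, integral_sub hgi (integrable_const _)]; simp [hm]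
    simp only [mul_add]
    rw [integral_add hwa (hwi.mul_const B), integral_mul_const, e1, e4]
    ring
  have hsq : Integrable (fun x => (inner ℝ a x) ^ 2 / (4 * B)) γ := by
    refine Integrable.div_const ?_ _
    exact (IsGaussian.memLp_dual γ (innerSL ℝ a) 2 (by simp)).integrable_sq
  have herr : ∫ x, w x * (inner ℝ a x + B) ∂γ - ∫ x, w x * H (inner ℝ a x) ∂γ ≤ 1 / (4 * B) := by
    have hi : Integrable (fun x => w x * (inner ℝ a x + B)) γ := by
      simp only [mul_add]
      exact hwa.add (hwi.mul_const B)
    rw [← integral_sub hi hwH]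
    calc _ ≤ ∫ x, (inner ℝ a x) ^ 2 / (4 * B) ∂γ := by
          refine integral_mono (hi.sub hwH) hsq fun x => ?_
          simp only []
          rw [← mul_sub]
          refine (le_abs_self _).trans ?_
          rw [abs_mul]
          exact (mul_le_of_le_one_left (abs_nonneg _) (hw1 x)).trans
            (abs_add_sub_setIntegral_indicator_le hB _)
      _ = 1 / (4 * B) := by
          rw [integral_div, integral_inner_sq_stdGaussian, ha1, one_pow]
  have e1 : ‖v‖ ≤ 2 * B * M + 1 / (4 * B) := by linarith
  have e2 : 2 * B * M + 1 / (4 * B) = M / ‖v‖ + ‖v‖ / 2 := by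
    rw [hBdef]; field_simp; ring
  rw [e2] at e1
  have e3 : ‖v‖ / 2 ≤ M / ‖v‖ := by linarith
  rw [le_div_iff₀ hv0] at e3
  linarith

end GaussianNoise

/-! ### Measurability of the half-space supremum -/

namespace GaussianNoise

open Filter Topology in
/-- Every half-space is a pointwise limit of half-spaces with parameters in a dense sequence. -/
lemma exists_seq_tendsto_indicator_halfSpace {E : Type*} [NormedAddCommGroup E]
    [InnerProductSpace ℝ E] {d : ℕ → E × ℝ} (hd : DenseRange d) (a : E) (b : ℝ) :
    ∃ φ : ℕ → ℕ, ∀ x : E, Tendsto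
      (fun k => {x | inner ℝ x (d (φ k)).1 ≤ (d (φ k)).2}.indicator (fun _ => (1 : ℝ)) x) atTop
      (𝓝 ({x | inner ℝ x a ≤ b}.indicator (fun _ => (1 : ℝ)) x)) := by
  -- With `ε = 1 / (k + 1)`, the normal moves by less than `ε²` while the threshold rises by more
  -- than `ε`. Hence even boundary points eventually stay inside, and outside points stay outside
  -- since both changes tend to zero.
  have hex (k : ℕ) : ∃ i, d i ∈ Metric.ball a ((1 / ((k : ℝ) + 1)) ^ 2) ×ˢ
      Set.Ioo (b + 1 / ((k : ℝ) + 1)) (b + 2 / ((k : ℝ) + 1)) := by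
    refine hd.exists_mem_open (Metric.isOpen_ball.prod isOpen_Ioo) (Set.Nonempty.prod ?_ ?_)
    · exact ⟨a, Metric.mem_ball_self (by positivity)⟩
    · refine Set.nonempty_Ioo.2 ((add_lt_add_iff_left b).2 ?_)
      gcongr
      norm_num
  choose φ hφ using hex
  refine ⟨φ, fun x => tendsto_const_nhds.congr' ?_⟩
  have hε : Tendsto (fun k : ℕ => 1 / ((k : ℝ) + 1)) atTop (𝓝 0) :=
    tendsto_one_div_add_atTop_nhds_zero_nat
  have hclose (k : ℕ) : |inner ℝ x (d (φ k)).1 - inner ℝ x a| ≤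
      ‖x‖ * (1 / ((k : ℝ) + 1)) ^ 2 := by
    rw [← inner_sub_right]
    refine (abs_real_inner_le_norm _ _).trans (mul_le_mul_of_nonneg_left ?_ (norm_nonneg _))
    rw [← dist_eq_norm]
    exact (Metric.mem_ball.1 (hφ k).1).le
  by_cases hx : inner ℝ x a ≤ b
  · have hsmall : ∀ᶠ k : ℕ in atTop, ‖x‖ * (1 / ((k : ℝ) + 1)) < 1 := by
      have := hε.const_mul ‖x‖
      rw [mul_zero] at this
      exact this.eventually_lt_const zero_lt_one
    filter_upwards [hsmall] with k hk
    have hpos : (0 : ℝ) < 1 / ((k : ℝ) + 1) := by positivity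
    have h1 := (abs_le.1 (hclose k)).2
    have h2 := (hφ k).2.1
    have : inner ℝ x (d (φ k)).1 ≤ (d (φ k)).2 := by nlinarith
    simp [hx, this]
  · rw [not_le] at hx
    have hlim : Tendsto (fun k : ℕ => ‖x‖ * (1 / ((k : ℝ) + 1)) ^ 2 + 2 * (1 / ((k : ℝ) + 1)))
        atTop (𝓝 0) := by
      simpa using ((hε.pow 2).const_mul ‖x‖).add (hε.const_mul 2)
    filter_upwards [hlim.eventually_lt_const (sub_pos.2 hx)] with k hk
    have h1 := (abs_le.1 (hclose k)).1
    have h2 := (hφ k).2.2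
    have h3 : 2 / ((k : ℝ) + 1) = 2 * (1 / ((k : ℝ) + 1)) := by ring
    have : ¬ inner ℝ x (d (φ k)).1 ≤ (d (φ k)).2 := by rw [not_le]; linarith
    simp [hx, this]

variable {n : ℕ} {f g : EuclideanSpace ℝ (Fin n) → ℝ} {t : ℝ}

lemma measurableSet_halfSpace (a : EuclideanSpace ℝ (Fin n)) (b : ℝ) :
    MeasurableSet {x : EuclideanSpace ℝ (Fin n) | inner ℝ x a ≤ b} :=
  measurableSet_le (by fun_prop) measurable_const

/-- Dominated convergence carries the pointwise approximation of indicators over to covariances. The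
countable supremum is what makes `M(f_{t,y})` measurable in `y`. -/
lemma halfSpaceCorrelation_eq_iSup (hg : Measurable g) (hg1 : ∀ x, g x ∈ Set.Icc (0 : ℝ) 1)
    {d : ℕ → EuclideanSpace ℝ (Fin n) × ℝ} (hd : DenseRange d) :
    halfSpaceCorrelation g = ⨆ k, cov[g, {x | inner ℝ x (d k).1 ≤ (d k).2}.indicator
      (fun _ => (1 : ℝ)); gammaMeasure n] := by
  have hgi : Integrable g (gammaMeasure n) := Integrable.of_bound hg.aestronglyMeasurable 1
    (ae_of_all _ fun x => by rw [Real.norm_of_nonneg (hg1 x).1]; exact (hg1 x).2)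
  have hbdd : BddAbove (Set.range fun k => cov[g, {x | inner ℝ x (d k).1 ≤ (d k).2}.indicator
      (fun _ => (1 : ℝ)); gammaMeasure n]) :=
    ⟨halfSpaceCorrelation g, by
      rintro _ ⟨k, rfl⟩
      exact covariance_le_halfSpaceCorrelation hg1 _ _⟩
  refine le_antisymm (csSup_le ⟨_, _, ⟨0, 0, rfl⟩, rfl⟩ ?_)
    (ciSup_le fun k => covariance_le_halfSpaceCorrelation hg1 _ _)
  rintro _ ⟨_, ⟨a, b, rfl⟩, rfl⟩
  obtain ⟨φ, hφ⟩ := exists_seq_tendsto_indicator_halfSpace hd a b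
  refine le_of_tendsto' (f := fun k => cov[g, {x | inner ℝ x (d (φ k)).1 ≤ (d (φ k)).2}.indicator
      (fun _ => (1 : ℝ)); gammaMeasure n]) (x := Filter.atTop) ?_ fun k => le_ciSup hbdd (φ k)
  simp_rw [covariance_indicator_one hgi (measurableSet_halfSpace _ _)]
  refine tendsto_integral_of_dominated_convergence (fun _ => 1) (fun k => ?_)
    (integrable_const _) (fun k => ae_of_all _ fun x => ?_)
    (ae_of_all _ fun x => (hφ x).const_mul _)
  · exact ((hg.sub_const _).mul
      (measurable_const.indicator (measurableSet_halfSpace _ _))).aestronglyMeasurable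
  · rw [norm_mul]
    obtain ⟨h, h'⟩ := indicator_one_mem_Icc {x | inner ℝ x (d (φ k)).1 ≤ (d (φ k)).2} x
    exact mul_le_one₀ (abs_sub_integral_le_one hg1 x) (norm_nonneg _)
      (by rwa [Real.norm_of_nonneg h])

lemma measurable_covariance_scaleShift (hf : Measurable f) (hf1 : ∀ x, f x ∈ Set.Icc (0 : ℝ) 1)
    (a : EuclideanSpace ℝ (Fin n)) (b : ℝ) :
    Measurable fun y => cov[scaleShift t y f, {x | inner ℝ x a ≤ b}.indicator
      (fun _ => (1 : ℝ)); gammaMeasure n] := by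
  have hu := measurable_scaleShift_uncurry (t := t) hf
  have hgi (y) : Integrable (scaleShift t y f) (gammaMeasure n) :=
    Integrable.of_bound (measurable_scaleShift hf y).aestronglyMeasurable 1
      (ae_of_all _ fun x => by
        rw [scaleShift, Real.norm_of_nonneg (hf1 _).1]; exact (hf1 _).2)
  simp_rw [fun y => covariance_indicator_one (hgi y) (measurableSet_halfSpace a b)]
  have hmean : Measurable fun y => ∫ x, scaleShift t y f x ∂(gammaMeasure n) :=
    (StronglyMeasurable.integral_prod_right (f := fun y x => scaleShift t y f x)
      hu.stronglyMeasurable).measurable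
  exact (StronglyMeasurable.integral_prod_right
    (f := fun y x => (scaleShift t y f x - ∫ x, scaleShift t y f x ∂(gammaMeasure n)) *
      {x | inner ℝ x a ≤ b}.indicator (fun _ => (1 : ℝ)) x)
    (((hu.sub (hmean.comp measurable_fst)).mul ((measurable_const.indicator
      (measurableSet_halfSpace a b)).comp measurable_snd)).stronglyMeasurable)).measurable

lemma integrable_halfSpaceCorrelation_scaleShift (hf : Measurable f)
    (hf1 : ∀ x, f x ∈ Set.Icc (0 : ℝ) 1) :
    Integrable (fun y => halfSpaceCorrelation (scaleShift t y f)) (gammaMeasure n) := by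
  have hd := TopologicalSpace.denseRange_denseSeq (EuclideanSpace ℝ (Fin n) × ℝ)
  have hm : Measurable fun y => halfSpaceCorrelation (scaleShift t y f) := by
    simp_rw [fun y => halfSpaceCorrelation_eq_iSup (measurable_scaleShift (t := t) hf y)
      (fun x => hf1 _) hd]
    exact Measurable.iSup fun k => measurable_covariance_scaleShift hf hf1 _ _
  refine Integrable.of_bound hm.aestronglyMeasurable 1 (ae_of_all _ fun y => ?_)
  rw [Real.norm_of_nonneg (halfSpaceCorrelation_nonneg (g := scaleShift t y f) fun x => hf1 _)]
  refine csSup_le ⟨_, _, ⟨0, 0, rfl⟩, rfl⟩ ?_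
  rintro _ ⟨A, -, rfl⟩
  exact (le_abs_self _).trans (abs_covariance_le_one (fun x => hf1 _) (indicator_one_mem_Icc A))

end GaussianNoise

/-! ### Conclusion -/

theorem mainTheorem5 :
    ∃ c : ℝ, 0 < c ∧
      ∀ (n : ℕ) (f : EuclideanSpace ℝ (Fin n) → ℝ), Measurable f →
        (∀ x, f x ∈ Set.Icc (0 : ℝ) 1) →
        ∀ t : ℝ, 0 < t →
          Integrable (fun y => GaussianNoise.halfSpaceCorrelation (GaussianNoise.scaleShift t y f))
            (GaussianNoise.gammaMeasure n) ∧
          c * (Real.exp (2 * t) - 1) *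
              Var[GaussianNoise.ornsteinUhlenbeck t f; GaussianNoise.gammaMeasure n] ≤
            ∫ y, GaussianNoise.halfSpaceCorrelation (GaussianNoise.scaleShift t y f)
              ∂(GaussianNoise.gammaMeasure n) := by
  -- The constant is the half-space factor `1 / 2` divided by the Poincaré factor `(π / 2) ^ 2`.
  refine ⟨2 / Real.pi ^ 2, by positivity, fun n f hf hf1 t ht =>
    ⟨GaussianNoise.integrable_halfSpaceCorrelation_scaleShift hf hf1, ?_⟩⟩
  have habs : ∀ x, |f x| ≤ 1 := fun x => by rw [abs_of_nonneg (hf1 x).1]; exact (hf1 x).2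
  have hvar := GaussianNoise.variance_ornsteinUhlenbeck_le ht hf habs
  set I := ∫ y, ‖GaussianNoise.firstMoment t f y‖ ^ 2 ∂(GaussianNoise.gammaMeasure n)
  have hs := GaussianNoise.one_sub_exp_pos ht
  have hk : (Real.exp (2 * t) - 1) *
      (Real.exp (-t) / √(1 - Real.exp (-2 * t))) ^ 2 = 1 := by
    rw [div_pow, Real.sq_sqrt hs.le, ← mul_div_assoc, div_eq_one_iff_eq hs.ne', ← Real.exp_nat_mul,
      sub_mul, ← Real.exp_add]
    push_cast
    ring_nf
    simp
  have hexp : 0 ≤ Real.exp (2 * t) - 1 := by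
    have := Real.add_one_le_exp (2 * t)
    linarith
  calc _ ≤ 2 / Real.pi ^ 2 * (Real.exp (2 * t) - 1) * ((Real.pi / 2) ^ 2 *
          (Real.exp (-t) / √(1 - Real.exp (-2 * t))) ^ 2 * I) :=
        mul_le_mul_of_nonneg_left hvar (mul_nonneg (by positivity) hexp)
    _ = (2 / Real.pi ^ 2 * (Real.pi / 2) ^ 2) * ((Real.exp (2 * t) - 1) *
          (Real.exp (-t) / √(1 - Real.exp (-2 * t))) ^ 2) * I := by ring
    _ = I / 2 := by rw [hk]; field_simp
    _ = ∫ y, ‖GaussianNoise.firstMoment t f y‖ ^ 2 / 2 ∂(GaussianNoise.gammaMeasure n) :=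
        (integral_div _ _).symm
    _ ≤ _ := by
        refine integral_mono_of_nonneg (ae_of_all _ fun y => by positivity)
          (GaussianNoise.integrable_halfSpaceCorrelation_scaleShift hf hf1)
          (ae_of_all _ fun y => ?_)
        exact GaussianNoise.sq_norm_integral_smul_id_le
          (GaussianNoise.measurable_scaleShift hf y) fun x => hf1 _
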